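/- Let $n\ge 3$, let $|\cdot|$ be the Euclidean norm on $\mathbb{R}^n$, let $B^n\subset\mathbb{R}^n$ be the open unit ball, and put $$C_n=\frac{(n+1)\sqrt{\pi}\,\Gamma\left(\frac{n+1}{2}\right)}{8n\,\Gamma\left(\frac n2+1\right)}.$$ Let $a,b\in\mathbb{R}$. (i) Let $D\subset B^n$ be open and let $\chi:D\to[-1,1]$ be a $C^2$ function with $$|\Delta\chi(x)|\le a|\nabla\chi(x)|^2+b\qquad\text{for all }x\in D.$$ Then there is a constant $c_5=c_5(a,b,n,\chi)>0$ such that for every $x_0$ and $r_0>0$ for which the open ball $\{x:|x-x_0|<r_0\}$ is contained in $D$, $$|\nabla\chi(x_0)|\le c_5\left(1+\frac{\sup_{|x-x_0|<r_0}|\chi(x)-\chi(x_0)|}{r_0}\right).\tag{1}$$ (If the closed ball $\{x:|x-x_0|\le r_0\}$ is contained in $D$, the supremum equals $\max_{|x-x_0|\le r_0}|\chi(x)-\chi(x_0)|$.) (ii) If $a\le C_n$, then $c_5$ can be chosen independently of $\chi$ (and of $D$): there is a constant $c_5=c_5(a,b,n)>0$ such that (1) holds for all $D$, $\chi$ as in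 (i) and all $x_0$, $r_0>0$ with $\{x:|x-x_0|<r_0\}\subset D$. -/

import Mathlib

/-- The constant `C_n = (n + 1) √π Γ((n + 1) / 2) / (8 n Γ(n / 2 + 1))`. -/
noncomputable def poissonConst (n : ℕ) : ℝ :=
  ((n : ℝ) + 1) * Real.sqrt Real.pi * Real.Gamma (((n : ℝ) + 1) / 2) /
    (8 * (n : ℝ) * Real.Gamma ((n : ℝ) / 2 + 1))

/-- `D` is an open subset of the open unit ball of `ℝⁿ` and `χ : D → [-1, 1]` is a `C²` function
with `|Δχ| ≤ a |∇χ|² + b` on `D`. Only the values of `χ` on `D` matter. -/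
structure PoissonDiffIneq (n : ℕ) (a b : ℝ) (D : Set (EuclideanSpace ℝ (Fin n)))
    (χ : EuclideanSpace ℝ (Fin n) → ℝ) : Prop where
  isOpen : IsOpen D
  subset_ball : D ⊆ Metric.ball 0 1
  contDiffOn : ContDiffOn ℝ 2 χ D
  mem_Icc : ∀ x ∈ D, χ x ∈ Set.Icc (-1 : ℝ) 1
  laplacian_le : ∀ x ∈ D, |Laplacian.laplacian χ x| ≤ a * ‖fderiv ℝ χ x‖ ^ 2 + b

/-- The interior gradient estimate for `χ` on `D` with the constant `c`: for every ball
`B(x₀, r₀) ⊆ D`, `|∇χ(x₀)| ≤ c (1 + sup_{|x - x₀| < r₀} |χ(x) - χ(x₀)| / r₀)`. By continuity the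
supremum is the maximum over the closed ball whenever the closed ball lies in `D`. -/
def InteriorGradientEstimate (n : ℕ) (c : ℝ) (D : Set (EuclideanSpace ℝ (Fin n)))
    (χ : EuclideanSpace ℝ (Fin n) → ℝ) : Prop :=
  ∀ (x₀ : EuclideanSpace ℝ (Fin n)) (r₀ : ℝ), 0 < r₀ → Metric.ball x₀ r₀ ⊆ D →
    ‖fderiv ℝ χ x₀‖ ≤
      c * (1 + sSup ((fun x => |χ x - χ x₀|) '' Metric.ball x₀ r₀) / r₀)

open MeasureTheory Set Filter Topology
open scoped InnerProductSpace

/-! The natural growth condition `|Δu| ≤ κ|∇u|² + B` is critical: the gradient term scales like the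
Laplacian, so it can be absorbed only where `u` oscillates little. Boundedness of `u` supplies that
smallness at a quantitative scale.

Put `w = exp (κu)`. Then `Δw = κw(Δu + κ|∇u|²)` is bounded below without any gradient term, so `w`
obeys a mean value inequality. Applied to `u` and to `-u`, this gives a weak Harnack inequality
(`exists_weak_harnack`), hence geometric decay of oscillation (`exists_oscillation_decay`) and a
radius `δr`, with `δ` depending only on `κ`, `B`, `ε` and the space, on which `u` oscillates by at
most `ε` (`exists_oscillation_le`).

In `exists_gradient_bound`, the quantity `(R - |z - x₀|)|∇u(z)|` is maximised over a ball of radius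
`R < δr`. Near the maximum point `|∇u|` is at most twice its natural size there, so the linear
estimate `norm_fderiv_le_of_laplacian_le` applies on a small ball, and small oscillation absorbs the
terms growing with the maximum. The constant involves only `κ`, `B` and the space, which gives both
parts of the theorem.

Averages use the weights `η_k = (1 - |y|²)₊ᵏ`, for which `y η₂ = -∇η₃/6`; differentiating an average
in its radius is then a single integration by parts. -/

theorem hasDerivAt_max_zero_pow (k : ℕ) (s : ℝ) :
    HasDerivAt (fun s : ℝ => max 0 s ^ (k + 2)) ((k + 2) * max 0 s ^ (k + 1)) s := by
  rcases lt_trichotomy s 0 with hs | rfl | hs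
  · rw [max_eq_left hs.le]
    have : (fun s : ℝ => max 0 s ^ (k + 2)) =ᶠ[𝓝 s] fun _ => 0 := by
      filter_upwards [Iio_mem_nhds hs] with t ht
      rw [max_eq_left (le_of_lt ht)]; simp
    simpa using (hasDerivAt_const s (0 : ℝ)).congr_of_eventuallyEq this
  -- At the kink the function is `O(h ^ (k + 2))`, hence `o(h)`, because the exponent is at least 2.
  · rw [max_self, zero_pow (by omega), mul_zero]
    rw [hasDerivAt_iff_isLittleO_nhds_zero]
    simp only [zero_add, max_self, ne_eq, Nat.add_eq_zero_iff, OfNat.ofNat_ne_zero, and_false,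
      not_false_eq_true, zero_pow, sub_zero, smul_eq_mul, mul_zero]
    refine Asymptotics.IsBigO.trans_isLittleO (g := fun h : ℝ => h ^ (k + 2)) ?_ ?_
    · refine Asymptotics.isBigO_of_le _ fun h => ?_
      rw [norm_pow, norm_pow]
      refine pow_le_pow_left₀ (norm_nonneg _) ?_ _
      rw [Real.norm_of_nonneg (le_max_left _ _)]
      exact max_le (norm_nonneg _) (le_abs_self h)
    · simpa using Asymptotics.isLittleO_pow_id (𝕜 := ℝ) (n := k + 2) (by omega)
  · rw [max_eq_right hs.le]
    have : (fun s : ℝ => max 0 s ^ (k + 2)) =ᶠ[𝓝 s] fun s => s ^ (k + 2) := by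
      filter_upwards [Ioi_mem_nhds hs] with t ht
      rw [max_eq_right (le_of_lt ht)]
    have h := (hasDerivAt_pow (k + 2) s).congr_of_eventuallyEq this
    simpa using h

/-! ### Compactly supported polynomial weights -/

section

variable {E : Type*} [NormedAddCommGroup E]

/-- The truncated polynomial `(1 - ‖y‖²)₊ᵏ`. -/
noncomputable def truncPoly (k : ℕ) (y : E) : ℝ := max 0 (1 - ‖y‖ ^ 2) ^ k

theorem truncPoly_nonneg (k : ℕ) (y : E) : 0 ≤ truncPoly k y := by
  unfold truncPoly; positivity

theorem truncPoly_le_one (k : ℕ) (y : E) : truncPoly k y ≤ 1 :=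
  pow_le_one₀ (le_max_left _ _) (max_le zero_le_one (by nlinarith [sq_nonneg ‖y‖]))

theorem truncPoly_eq_zero (k : ℕ) {y : E} (hy : 1 ≤ ‖y‖) : truncPoly (k + 1) y = 0 := by
  unfold truncPoly
  rw [max_eq_left (by nlinarith), zero_pow (by omega)]

theorem continuous_truncPoly (k : ℕ) : Continuous (truncPoly k : E → ℝ) := by
  unfold truncPoly; fun_prop

variable [InnerProductSpace ℝ E]

/-- Each derivative lowers the exponent by one and produces the radial factor `y`; exponent 3 thus
leaves two continuous derivatives. -/
theorem hasFDerivAt_truncPoly (k : ℕ) (y : E) :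
    HasFDerivAt (truncPoly (k + 2) : E → ℝ)
      ((-(2 * ((k : ℝ) + 2)) * truncPoly (k + 1) y) • innerSL ℝ y) y := by
  have h1 : HasFDerivAt (fun y : E => 1 - ‖y‖ ^ 2) (-(2 • innerSL ℝ y)) y :=
    ((hasStrictFDerivAt_norm_sq y).hasFDerivAt).const_sub 1
  refine ((hasDerivAt_max_zero_pow k (1 - ‖y‖ ^ 2)).comp_hasFDerivAt y h1).congr_fderiv ?_
  ext v
  simp [truncPoly]
  ring

theorem fderiv_truncPoly_apply (k : ℕ) (y v : E) :
    fderiv ℝ (truncPoly (k + 2) : E → ℝ) y v =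
      -(2 * ((k : ℝ) + 2)) * truncPoly (k + 1) y * ⟪y, v⟫_ℝ := by
  rw [(hasFDerivAt_truncPoly k y).fderiv]; simp

theorem contDiff_one_truncPoly (k : ℕ) : ContDiff ℝ 1 (truncPoly (k + 2) : E → ℝ) := by
  rw [contDiff_one_iff_fderiv]
  refine ⟨fun y => (hasFDerivAt_truncPoly k y).differentiableAt, ?_⟩
  have : fderiv ℝ (truncPoly (k + 2) : E → ℝ) =
      fun y => (-(2 * ((k : ℝ) + 2)) * truncPoly (k + 1) y) • innerSL ℝ y :=
    funext fun y => (hasFDerivAt_truncPoly k y).fderiv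
  rw [this]
  have := continuous_truncPoly (E := E) (k + 1)
  fun_prop

theorem contDiff_two_truncPoly (k : ℕ) : ContDiff ℝ 2 (truncPoly (k + 3) : E → ℝ) := by
  rw [show (2 : WithTop ℕ∞) = 1 + 1 by norm_num, contDiff_succ_iff_fderiv]
  refine ⟨fun y => (hasFDerivAt_truncPoly (k + 1) y).differentiableAt, by simp, ?_⟩
  have : fderiv ℝ (truncPoly (k + 3) : E → ℝ) =
      fun y => (-(2 * (((k + 1 : ℕ) : ℝ) + 2)) * truncPoly (k + 2) y) • innerSL ℝ y :=
    funext fun y => (hasFDerivAt_truncPoly (k + 1) y).fderiv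
  rw [this]
  exact (contDiff_const.mul (contDiff_one_truncPoly k)).smul (innerSL ℝ).contDiff

theorem abs_fderiv_truncPoly_le (k : ℕ) (y v : E) :
    |fderiv ℝ (truncPoly (k + 2) : E → ℝ) y v| ≤ 2 * ((k : ℝ) + 2) * ‖v‖ := by
  rw [fderiv_truncPoly_apply]
  rcases le_total 1 ‖y‖ with hy | hy
  · rw [truncPoly_eq_zero k hy]; simp; positivity
  · rw [abs_mul, abs_mul, abs_neg, abs_of_nonneg (truncPoly_nonneg _ _),
      abs_of_nonneg (by positivity), mul_assoc]
    refine mul_le_mul_of_nonneg_left ?_ (by positivity)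
    have := abs_real_inner_le_norm y v
    calc truncPoly (k + 1) y * |⟪y, v⟫_ℝ| ≤ 1 * (1 * ‖v‖) := by
          refine mul_le_mul (truncPoly_le_one _ _) (this.trans ?_) (abs_nonneg _) zero_le_one
          gcongr
      _ = ‖v‖ := by ring

omit [InnerProductSpace ℝ E] in
theorem hasCompactSupport_of_eq_zero [NormedSpace ℝ E] [FiniteDimensional ℝ E] {f : E → ℝ}
    (h : ∀ y, 1 ≤ ‖y‖ → f y = 0) : HasCompactSupport f := by
  refine HasCompactSupport.intro (isCompact_closedBall (0 : E) 1) fun y hy => h y ?_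
  simp only [Metric.mem_closedBall, dist_zero_right, not_le] at hy
  exact hy.le

end

/-! ### Second derivatives and the Laplacian in an orthonormal basis -/

section

variable {E : Type*} [NormedAddCommGroup E] [InnerProductSpace ℝ E] {u : E → ℝ}

theorem ContDiff.fderiv_apply_const (hu : ContDiff ℝ 2 u) (v : E) :
    ContDiff ℝ 1 (fun x => fderiv ℝ u x v) :=
  (hu.fderiv_right (m := 1) (by norm_num)).clm_apply contDiff_const

theorem fderiv_fderiv_apply (hu : ContDiff ℝ 2 u) (x v w : E) :
    fderiv ℝ (fun z => fderiv ℝ u z v) x w = fderiv ℝ (fderiv ℝ u) x w v := by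
  have h : DifferentiableAt ℝ (fderiv ℝ u) x :=
    ((hu.fderiv_right (m := 1) (by norm_num)).differentiable (by norm_num)).differentiableAt
  rw [fderiv_clm_apply h (differentiableAt_const v)]
  simp

theorem fderiv_fderiv_apply_comm (hu : ContDiff ℝ 2 u) (x v w : E) :
    fderiv ℝ (fun z => fderiv ℝ u z v) x w = fderiv ℝ (fun z => fderiv ℝ u z w) x v := by
  rw [fderiv_fderiv_apply hu, fderiv_fderiv_apply hu]
  exact (hu.contDiffAt.isSymmSndFDerivAt (by simp)).eq w v

variable [FiniteDimensional ℝ E]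

theorem laplacian_eq_sum_fderiv (hu : ContDiff ℝ 2 u) {ι : Type*} [Fintype ι]
    (b : OrthonormalBasis ι ℝ E) (x : E) :
    Laplacian.laplacian u x = ∑ i, fderiv ℝ (fun z => fderiv ℝ u z (b i)) x (b i) := by
  rw [InnerProductSpace.laplacian_eq_iteratedFDeriv_orthonormalBasis u b]
  refine Finset.sum_congr rfl fun i _ => ?_
  rw [iteratedFDeriv_two_apply, fderiv_fderiv_apply hu]
  simp

theorem continuous_laplacian (hu : ContDiff ℝ 2 u) : Continuous (Laplacian.laplacian u) := by
  have : Laplacian.laplacian u = fun x => ∑ i, fderiv ℝ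
      (fun z => fderiv ℝ u z (stdOrthonormalBasis ℝ E i)) x (stdOrthonormalBasis ℝ E i) :=
    funext fun x => laplacian_eq_sum_fderiv hu _ x
  rw [this]
  refine continuous_finsetSum _ fun i _ => ?_
  exact ((hu.fderiv_apply_const _).continuous_fderiv (by norm_num)).clm_apply continuous_const

theorem sum_fderiv_sq {ι : Type*} [Fintype ι] (b : OrthonormalBasis ι ℝ E) (x : E) :
    ∑ i, fderiv ℝ u x (b i) ^ 2 = ‖fderiv ℝ u x‖ ^ 2 := by
  set g := (InnerProductSpace.toDual ℝ E).symm (fderiv ℝ u x) with hg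
  have h : ∀ v, fderiv ℝ u x v = ⟪g, v⟫_ℝ := fun v => by
    rw [hg, InnerProductSpace.toDual_symm_apply]
  have hn : ‖fderiv ℝ u x‖ = ‖g‖ := by rw [hg, LinearIsometryEquiv.norm_map]
  simp only [h, hn]
  rw [← b.sum_sq_norm_inner_left g]
  simp

/-- The chain rule for the Laplacian of `exp (κ u)`. -/
theorem laplacian_exp (hu : ContDiff ℝ 2 u) (κ : ℝ) (x : E) :
    Laplacian.laplacian (fun x => Real.exp (κ * u x)) x =
      κ * Real.exp (κ * u x) * (Laplacian.laplacian u x + κ * ‖fderiv ℝ u x‖ ^ 2) := by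
  set b := stdOrthonormalBasis ℝ E
  have hw : ContDiff ℝ 2 (fun x => Real.exp (κ * u x)) :=
    Real.contDiff_exp.comp (contDiff_const.mul hu)
  have hd : ∀ z, HasFDerivAt u (fderiv ℝ u z) z := fun z =>
    (hu.differentiable (by norm_num) z).hasFDerivAt
  have hdw : ∀ z, HasFDerivAt (fun x => Real.exp (κ * u x))
      (Real.exp (κ * u z) • (κ • fderiv ℝ u z)) z := fun z => ((hd z).const_mul κ).exp
  rw [laplacian_eq_sum_fderiv hw b, laplacian_eq_sum_fderiv hu b, ← sum_fderiv_sq b,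
    Finset.mul_sum, ← Finset.sum_add_distrib, Finset.mul_sum]
  refine Finset.sum_congr rfl fun i _ => ?_
  have h1 : (fun z => fderiv ℝ (fun x => Real.exp (κ * u x)) z (b i)) =
      fun z => Real.exp (κ * u z) * (κ * fderiv ℝ u z (b i)) := by
    funext z; rw [(hdw z).fderiv]; simp
  have h2 : HasFDerivAt (fun z => fderiv ℝ u z (b i))
      (fderiv ℝ (fun z => fderiv ℝ u z (b i)) x) x :=
    ((hu.fderiv_apply_const (b i)).differentiable (by norm_num) x).hasFDerivAt
  rw [h1, ((hdw x).fun_mul (h2.const_mul κ)).fderiv]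
  simp
  ring

end

/-! ### Integration by parts and radius derivatives of weighted averages -/

section

variable {E : Type*} [NormedAddCommGroup E] [InnerProductSpace ℝ E]

theorem fderiv_truncPoly_eq_zero (k : ℕ) {y : E} (hy : 1 ≤ ‖y‖) :
    fderiv ℝ (truncPoly (k + 2) : E → ℝ) y = 0 := by
  ext v
  rw [fderiv_truncPoly_apply, truncPoly_eq_zero k hy]
  simp

theorem fderiv_comp_add_smul {f : E → ℝ} (hf : ContDiff ℝ 1 f) (x y v : E) (t : ℝ) :
    fderiv ℝ (fun y => f (x + t • y)) y v = t * fderiv ℝ f (x + t • y) v := by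
  have h1 : HasFDerivAt (fun y : E => x + t • y) (t • ContinuousLinearMap.id ℝ E) y :=
    ((hasFDerivAt_id y).const_smul t).const_add x
  have h2 := (hf.differentiable (by norm_num) (x + t • y)).hasFDerivAt.comp y h1
  have h3 : fderiv ℝ (fun y => f (x + t • y)) y =
    (fderiv ℝ f (x + t • y)).comp (t • ContinuousLinearMap.id ℝ E) := h2.fderiv
  rw [h3]
  simp

theorem contDiff_comp_add_smul {f : E → ℝ} {k : WithTop ℕ∞} (hf : ContDiff ℝ k f) (x : E)
    (t : ℝ) : ContDiff ℝ k (fun y => f (x + t • y)) :=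
  hf.comp (contDiff_const.add (contDiff_id.const_smul t))

/-- Every term still carries a positive power of the weight, so a second integration by parts has no
boundary contribution. -/
theorem fderiv_fderiv_truncPoly_eq_zero (v : E) {y : E} (hy : 1 ≤ ‖y‖) :
    fderiv ℝ (fun z => fderiv ℝ (truncPoly 3 : E → ℝ) z v) y = 0 := by
  simp only [fderiv_truncPoly_apply 1]
  have h1 := hasFDerivAt_truncPoly 0 y
  have h2 : HasFDerivAt (fun z : E => ⟪z, v⟫_ℝ) ((innerSL ℝ).flip v) y :=
    ((innerSL ℝ).flip v).hasFDerivAt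
  rw [((h1.const_mul (-(2 * (((1 : ℕ) : ℝ) + 2)))).fun_mul h2).fderiv]
  simp [truncPoly_eq_zero 0 hy, truncPoly_eq_zero 1 hy]

theorem fderiv_apply_self_mul_truncPoly {ι : Type*} [Fintype ι] (b : OrthonormalBasis ι ℝ E)
    (L : E →L[ℝ] ℝ) (y : E) :
    L y * truncPoly 2 y = ∑ i, L (b i) * (-(1 / 6) * fderiv ℝ (truncPoly 3 : E → ℝ) y (b i)) := by
  have h : L y = ∑ i, L (⟪b i, y⟫_ℝ • b i) := by rw [← map_sum, b.sum_repr' y]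
  rw [h, Finset.sum_mul]
  refine Finset.sum_congr rfl fun i _ => ?_
  rw [fderiv_truncPoly_apply 1, real_inner_comm, map_smul, smul_eq_mul]
  push_cast
  ring

variable [FiniteDimensional ℝ E] [MeasurableSpace E] [BorelSpace E] {u : E → ℝ}

theorem integrable_mul_of_eq_zero {f g : E → ℝ} (hf : Continuous f) (hg : Continuous g)
    (h : ∀ y, 1 ≤ ‖y‖ → g y = 0) : Integrable (fun y => f y * g y) :=
  (hf.mul hg).integrable_of_hasCompactSupport (hasCompactSupport_of_eq_zero h).mul_left

theorem abs_integral_le_of_eq_zero {f : E → ℝ} {C : ℝ} (h0 : ∀ y, 1 ≤ ‖y‖ → f y = 0)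
    (hC : ∀ y, ‖y‖ < 1 → |f y| ≤ C) :
    |∫ y, f y| ≤ C * volume.real (Metric.ball (0 : E) 1) := by
  rw [← setIntegral_eq_integral_of_forall_compl_eq_zero (s := Metric.ball (0 : E) 1)]
  · rw [← Real.norm_eq_abs]
    exact norm_setIntegral_le_of_norm_le_const measure_ball_lt_top fun y hy =>
      hC y (by simpa using hy)
  · intro y hy
    exact h0 y (by simpa using hy)

theorem integral_mul_fderiv_eq_neg {f φ : E → ℝ} (hf : ContDiff ℝ 1 f) (hφ : ContDiff ℝ 1 φ)
    (h0 : ∀ y, 1 ≤ ‖y‖ → φ y = 0) (h0' : ∀ y, 1 ≤ ‖y‖ → fderiv ℝ φ y = 0) (v : E) :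
    ∫ y, f y * fderiv ℝ φ y v = -∫ y, fderiv ℝ f y v * φ y :=
  integral_mul_fderiv_eq_neg_fderiv_mul_of_integrable
    (integrable_mul_of_eq_zero ((hf.continuous_fderiv (by norm_num)).clm_apply continuous_const)
      hφ.continuous h0)
    (integrable_mul_of_eq_zero hf.continuous
      ((hφ.continuous_fderiv (by norm_num)).clm_apply continuous_const)
      fun y hy => by simp [h0' y hy])
    (integrable_mul_of_eq_zero hf.continuous hφ.continuous h0)
    (fun x _ => hf.differentiable (by norm_num) x) (fun x _ => hφ.differentiable (by norm_num) x)

theorem hasDerivAt_integral_comp_add_smul {f η : E → ℝ} (hf : ContDiff ℝ 1 f) (hη : Continuous η)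
    (h0 : ∀ y, 1 ≤ ‖y‖ → η y = 0) (x : E) (t : ℝ) :
    HasDerivAt (fun t : ℝ => ∫ y, f (x + t • y) * η y)
      (∫ y, fderiv ℝ f (x + t • y) y * η y) t := by
  have hc : Continuous fun p : ℝ × E => fderiv ℝ f (x + p.1 • p.2) p.2 * η p.2 := by
    have := hf.continuous_fderiv (by norm_num)
    fun_prop
  obtain ⟨C, hC⟩ := ((isCompact_closedBall t 1).prod
    (isCompact_closedBall (0 : E) 1)).exists_bound_of_continuousOn hc.continuousOn
  refine (hasDerivAt_integral_of_dominated_loc_of_deriv_le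
    (s := Metric.closedBall t 1) (bound := (Metric.closedBall (0 : E) 1).indicator fun _ => C)
    (F' := fun t y => fderiv ℝ f (x + t • y) y * η y)
    (Metric.closedBall_mem_nhds t one_pos) ?_ ?_ ?_ ?_ ?_ ?_).2
  · refine Eventually.of_forall fun s => ?_
    have := hf.continuous
    exact Continuous.aestronglyMeasurable (by fun_prop)
  · refine integrable_mul_of_eq_zero ?_ hη h0
    have := hf.continuous
    fun_prop
  · exact (hc.comp (by fun_prop : Continuous fun y : E => (t, y))).aestronglyMeasurable
  · refine Eventually.of_forall fun y s hs => ?_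
    by_cases hy : y ∈ Metric.closedBall (0 : E) 1
    · rw [indicator_of_mem hy]
      exact hC (s, y) ⟨hs, hy⟩
    · rw [indicator_of_notMem hy]
      simp only [Metric.mem_closedBall, dist_zero_right, not_le] at hy
      simp [h0 y hy.le]
  · exact (integrable_indicator_iff measurableSet_closedBall).2
      (integrableOn_const (by exact measure_closedBall_lt_top.ne))
  · refine Eventually.of_forall fun y s _ => ?_
    have h1 : HasDerivAt (fun s : ℝ => x + s • y) y s := by
      simpa using ((hasDerivAt_id s).smul_const y).const_add x
    exact ((hf.differentiable (by norm_num) _).hasFDerivAt.comp_hasDerivAt s h1).mul_const _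

theorem integral_fderiv_apply_self_mul_truncPoly {ι : Type*} [Fintype ι]
    (b : OrthonormalBasis ι ℝ E) {f : E → ℝ} (hf : ContDiff ℝ 1 f) (x : E) (t : ℝ) :
    ∫ y, fderiv ℝ f (x + t • y) y * truncPoly 2 y =
      -(1 / 6) * ∑ i, ∫ y, fderiv ℝ f (x + t • y) (b i) *
        fderiv ℝ (truncPoly 3 : E → ℝ) y (b i) := by
  have hc := hf.continuous_fderiv (by norm_num)
  have hd := (contDiff_one_truncPoly (E := E) 1).continuous_fderiv (by norm_num)
  simp only [fderiv_apply_self_mul_truncPoly b]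
  rw [integral_finsetSum, Finset.mul_sum]
  · refine Finset.sum_congr rfl fun i _ => ?_
    rw [← integral_const_mul]
    refine integral_congr_ae (Eventually.of_forall fun y => ?_)
    simp only []
    ring
  · intro i _
    refine integrable_mul_of_eq_zero (by fun_prop) (by fun_prop) fun y hy => ?_
    rw [fderiv_truncPoly_eq_zero 1 hy]
    simp

/-- Since `y η₂ = -∇η₃/6`, one integration by parts turns the radial derivative into a divergence;
the factor `t` comes from the chain rule. -/
theorem integral_fderiv_apply_self_eq_laplacian (hu : ContDiff ℝ 2 u) (x : E) (t : ℝ) :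
    ∫ y, fderiv ℝ u (x + t • y) y * truncPoly 2 y =
      t / 6 * ∫ y, Laplacian.laplacian u (x + t • y) * truncPoly 3 y := by
  set b := stdOrthonormalBasis ℝ E
  have hu1 : ContDiff ℝ 1 u := hu.of_le (by norm_num)
  rw [integral_fderiv_apply_self_mul_truncPoly b hu1]
  simp only [laplacian_eq_sum_fderiv hu b, Finset.sum_mul]
  rw [integral_finsetSum, Finset.mul_sum, Finset.mul_sum]
  · refine Finset.sum_congr rfl fun i _ => ?_
    have hi := hu.fderiv_apply_const (b i)
    rw [integral_mul_fderiv_eq_neg (contDiff_comp_add_smul hi x t) (contDiff_one_truncPoly 1)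
      (fun y => truncPoly_eq_zero 2) (fun y => fderiv_truncPoly_eq_zero 1)]
    simp only [fderiv_comp_add_smul hi, mul_assoc]
    rw [integral_const_mul]
    ring
  · intro i _
    have hi := (hu.fderiv_apply_const (b i)).continuous_fderiv (by norm_num)
    exact integrable_mul_of_eq_zero (by fun_prop) (continuous_truncPoly 3)
      fun y => truncPoly_eq_zero 2

theorem integral_fderiv_fderiv_mul_fderiv_comm {φ : E → ℝ} (hu : ContDiff ℝ 2 u)
    (hφ : ContDiff ℝ 2 φ) (h0 : ∀ y, 1 ≤ ‖y‖ → fderiv ℝ φ y = 0)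
    (h0' : ∀ v y, 1 ≤ ‖y‖ → fderiv ℝ (fun z => fderiv ℝ φ z v) y = 0) (v w : E) :
    ∫ y, fderiv ℝ (fun z => fderiv ℝ u z v) y w * fderiv ℝ φ y v =
      ∫ y, fderiv ℝ (fun z => fderiv ℝ u z v) y v * fderiv ℝ φ y w := by
  have h1 := integral_mul_fderiv_eq_neg (hu.fderiv_apply_const v) (hφ.fderiv_apply_const v)
    (fun y hy => by simp [h0 y hy]) (h0' v) w
  have h2 := integral_mul_fderiv_eq_neg (hu.fderiv_apply_const v) (hφ.fderiv_apply_const w)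
    (fun y hy => by simp [h0 y hy]) (h0' w) v
  simp only [fderiv_fderiv_apply_comm hφ _ v w] at h1
  linarith

/-- The previous identity for `∂ₑu` would need third derivatives. Exchanging `e` with each basis
direction by two integrations by parts puts `∂ₑ` on the weight instead, so `C²` suffices. -/
theorem integral_fderiv_fderiv_apply_self_eq_laplacian (hu : ContDiff ℝ 2 u) (x e : E) {t : ℝ}
    (ht : t ≠ 0) :
    ∫ y, fderiv ℝ (fun z => fderiv ℝ u z e) (x + t • y) y * truncPoly 2 y =
      -(1 / 6) * ∫ y, Laplacian.laplacian u (x + t • y) *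
        fderiv ℝ (truncPoly 3 : E → ℝ) y e := by
  set b := stdOrthonormalBasis ℝ E
  have hd := (contDiff_one_truncPoly (E := E) 1).continuous_fderiv (by norm_num)
  rw [integral_fderiv_apply_self_mul_truncPoly b (hu.fderiv_apply_const e)]
  simp only [laplacian_eq_sum_fderiv hu b, Finset.sum_mul]
  rw [integral_finsetSum]
  · congr 1
    refine Finset.sum_congr rfl fun i _ => ?_
    have hW := contDiff_comp_add_smul hu x t
    have hWd : ∀ v, (fun z => fderiv ℝ (fun y => u (x + t • y)) z v) =
        fun z => t * fderiv ℝ u (x + t • z) v := fun v =>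
      funext fun z => fderiv_comp_add_smul (hu.of_le (by norm_num)) x z v t
    have hWdd : ∀ v w y, fderiv ℝ (fun z => fderiv ℝ (fun y => u (x + t • y)) z v) y w =
        t * (t * fderiv ℝ (fun z => fderiv ℝ u z v) (x + t • y) w) := fun v w y => by
      rw [hWd, fderiv_const_mul
        ((contDiff_comp_add_smul (hu.fderiv_apply_const v) x t).differentiable (by norm_num) y)]
      rw [smul_apply, fderiv_comp_add_smul (hu.fderiv_apply_const v),
        smul_eq_mul]
    have h := integral_fderiv_fderiv_mul_fderiv_comm hW (contDiff_two_truncPoly 0)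
      (fun y => fderiv_truncPoly_eq_zero 1) (fun v y => fderiv_fderiv_truncPoly_eq_zero v) (b i) e
    simp only [hWdd, mul_assoc] at h
    simp only [integral_const_mul] at h
    simp only [fderiv_fderiv_apply_comm hu _ e]
    -- Rescaling produced a factor `t²` on both sides.
    exact mul_left_cancel₀ ht (mul_left_cancel₀ ht h)
  · intro i _
    have hi := (hu.fderiv_apply_const (b i)).continuous_fderiv (by norm_num)
    refine integrable_mul_of_eq_zero (by fun_prop) (by fun_prop) fun y hy => ?_
    rw [fderiv_truncPoly_eq_zero 1 hy]
    simp

end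

/-! ### Mean value inequality and gradient estimate for the Laplacian -/

section

variable {E : Type*} [NormedAddCommGroup E] [InnerProductSpace ℝ E]

theorem add_smul_mem_ball {x y : E} {t r : ℝ} (ht : 0 ≤ t) (htr : t ≤ r) (hr : 0 < r)
    (hy : ‖y‖ < 1) : x + t • y ∈ Metric.ball x r := by
  rw [mem_ball_iff_norm, add_sub_cancel_left, norm_smul, Real.norm_of_nonneg ht]
  nlinarith [norm_nonneg y]

variable [FiniteDimensional ℝ E] [MeasurableSpace E] [BorelSpace E] {u : E → ℝ}

theorem integral_truncPoly_two_pos : 0 < ∫ y : E, truncPoly 2 y :=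
  (continuous_truncPoly 2).integral_pos_of_hasCompactSupport_nonneg_nonzero (x := 0)
    (hasCompactSupport_of_eq_zero fun _ => truncPoly_eq_zero 1) (truncPoly_nonneg 2)
    (by simp [truncPoly])

theorem integrable_truncPoly (k : ℕ) : Integrable (truncPoly (k + 1) : E → ℝ) :=
  (continuous_truncPoly _).integrable_of_hasCompactSupport
    (hasCompactSupport_of_eq_zero fun _ => truncPoly_eq_zero k)

theorem integral_truncPoly_le (k : ℕ) :
    ∫ y : E, truncPoly (k + 1) y ≤ volume.real (Metric.ball (0 : E) 1) := by
  have := abs_integral_le_of_eq_zero (E := E) (C := 1) (fun y => truncPoly_eq_zero k)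
    fun y _ => (abs_of_nonneg (truncPoly_nonneg (k + 1) y)).trans_le (truncPoly_le_one _ _)
  rw [one_mul] at this
  exact (le_abs_self _).trans this

/-- A weighted mean value inequality for functions with Laplacian bounded below. -/
theorem mul_integral_truncPoly_sub_le (hu : ContDiff ℝ 2 u) {x : E} {r β : ℝ} (hr : 0 < r)
    (hβ : 0 ≤ β) (hΔ : ∀ z ∈ Metric.ball x r, -β ≤ Laplacian.laplacian u z) :
    u x * (∫ y : E, truncPoly 2 y) - r ^ 2 * β * volume.real (Metric.ball (0 : E) 1) ≤
      ∫ y, u (x + r • y) * truncPoly 2 y := by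
  set V := volume.real (Metric.ball (0 : E) 1) with hV
  have hV0 : 0 ≤ V := measureReal_nonneg
  have hd : ∀ t : ℝ, HasDerivAt (fun t : ℝ => ∫ y, u (x + t • y) * truncPoly 2 y)
      (t / 6 * ∫ y, Laplacian.laplacian u (x + t • y) * truncPoly 3 y) t := fun t => by
    rw [← integral_fderiv_apply_self_eq_laplacian hu]
    exact hasDerivAt_integral_comp_add_smul (hu.of_le (by norm_num)) (continuous_truncPoly 2)
      (fun y => truncPoly_eq_zero 1) x t
  have hlow : ∀ t ∈ interior (Icc 0 r), -(r * β * V) ≤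
      deriv (fun t : ℝ => ∫ y, u (x + t • y) * truncPoly 2 y) t := by
    intro t ht
    rw [interior_Icc] at ht
    rw [(hd t).deriv]
    have h1 : -(β * V) ≤ ∫ y, Laplacian.laplacian u (x + t • y) * truncPoly 3 y := by
      have h2 : ∫ y : E, -β * truncPoly 3 y ≤
          ∫ y, Laplacian.laplacian u (x + t • y) * truncPoly 3 y := by
        refine integral_mono ((integrable_truncPoly 2).const_mul _)
          (integrable_mul_of_eq_zero ?_ (continuous_truncPoly 3) fun y => truncPoly_eq_zero 2)
          fun y => ?_
        · have := continuous_laplacian hu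
          fun_prop
        · rcases le_or_gt 1 ‖y‖ with hy | hy
          · simp [truncPoly_eq_zero 2 hy]
          · exact mul_le_mul_of_nonneg_right
              (hΔ _ (add_smul_mem_ball ht.1.le ht.2.le hr hy)) (truncPoly_nonneg _ _)
      rw [integral_const_mul] at h2
      have h3 := mul_le_mul_of_nonneg_left (integral_truncPoly_le (E := E) 2) hβ
      linarith
    have h4 : 0 ≤ β * V := by positivity
    have h5 := mul_le_mul_of_nonneg_left h1 (by linarith [ht.1] : 0 ≤ t / 6)
    nlinarith [ht.1, ht.2]
  have h := (convex_Icc 0 r).mul_sub_le_image_sub_of_le_deriv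
    (fun t _ => (hd t).continuousAt.continuousWithinAt)
    (fun t _ => (hd t).differentiableAt.differentiableWithinAt) hlow 0 ⟨le_rfl, hr.le⟩ r
    ⟨hr.le, le_rfl⟩ hr.le
  simp only [zero_smul, add_zero, integral_const_mul, sub_zero] at h
  linarith

/-- The interior gradient estimate for Poisson's equation. -/
theorem norm_fderiv_le_of_laplacian_le (hu : ContDiff ℝ 2 u) {x : E} {r ω L : ℝ} (hr : 0 < r)
    (hω : 0 ≤ ω) (hL : 0 ≤ L) (hosc : ∀ z ∈ Metric.ball x r, |u z - u x| ≤ ω)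
    (hΔ : ∀ z ∈ Metric.ball x r, |Laplacian.laplacian u z| ≤ L) :
    ‖fderiv ℝ u x‖ ≤ 4 * volume.real (Metric.ball (0 : E) 1) / (∫ y : E, truncPoly 2 y) *
      (ω / r + r * L) := by
  set V := volume.real (Metric.ball (0 : E) 1) with hV
  set I := ∫ y : E, truncPoly 2 y with hI
  have hV0 : 0 ≤ V := measureReal_nonneg
  have hI0 : 0 < I := integral_truncPoly_two_pos
  have hd3 := (contDiff_one_truncPoly (E := E) 1).continuous_fderiv (by norm_num)
  refine ContinuousLinearMap.opNorm_le_bound _ (by positivity) fun e => ?_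
  have hue := hu.fderiv_apply_const e
  -- The weighted average of `∂ₑu` equals `∂ₑu(x) I` at `t = 0`. Its change up to `t = r` is
  -- controlled by `L`, its value at `t = r` by the oscillation.
  have hd : ∀ t : ℝ, HasDerivAt (fun t : ℝ => ∫ y, fderiv ℝ u (x + t • y) e * truncPoly 2 y)
      (∫ y, fderiv ℝ (fun z => fderiv ℝ u z e) (x + t • y) y * truncPoly 2 y) t := fun t =>
    hasDerivAt_integral_comp_add_smul hue (continuous_truncPoly 2)
      (fun y => truncPoly_eq_zero 1) x t
  have hdb : ∀ t ∈ interior (Icc 0 r),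
      ‖deriv (fun t : ℝ => ∫ y, fderiv ℝ u (x + t • y) e * truncPoly 2 y) t‖ ≤ L * ‖e‖ * V := by
    intro t ht
    rw [interior_Icc] at ht
    rw [(hd t).deriv, integral_fderiv_fderiv_apply_self_eq_laplacian hu x e ht.1.ne', norm_mul,
      Real.norm_eq_abs, Real.norm_eq_abs]
    have h1 := abs_integral_le_of_eq_zero (E := E) (C := L * (6 * ‖e‖))
      (f := fun y => Laplacian.laplacian u (x + t • y) * fderiv ℝ (truncPoly 3 : E → ℝ) y e)
      (fun y hy => by simp [fderiv_truncPoly_eq_zero 1 hy]) fun y hy => by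
        rw [abs_mul]
        refine mul_le_mul (hΔ _ (add_smul_mem_ball ht.1.le ht.2.le hr hy)) ?_ (abs_nonneg _) hL
        refine (abs_fderiv_truncPoly_le 1 y e).trans_eq ?_
        norm_num
    have h2 : |(-(1 / 6) : ℝ)| = 1 / 6 := by norm_num
    rw [h2]
    linarith
  have hcont : ContinuousOn (fun t : ℝ => ∫ y, fderiv ℝ u (x + t • y) e * truncPoly 2 y)
      (Icc 0 r) := fun t _ => (hd t).continuousAt.continuousWithinAt
  have hdiff : DifferentiableOn ℝ (fun t : ℝ => ∫ y, fderiv ℝ u (x + t • y) e * truncPoly 2 y)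
      (interior (Icc 0 r)) := fun t _ => (hd t).differentiableAt.differentiableWithinAt
  have h : |(∫ y, fderiv ℝ u (x + r • y) e * truncPoly 2 y) - fderiv ℝ u x e * I| ≤
      L * ‖e‖ * V * r := by
    have hup := (convex_Icc 0 r).image_sub_le_mul_sub_of_deriv_le hcont hdiff
      (fun t ht => (abs_le.1 (hdb t ht)).2) 0 ⟨le_rfl, hr.le⟩ r ⟨hr.le, le_rfl⟩ hr.le
    have hlo := (convex_Icc 0 r).mul_sub_le_image_sub_of_le_deriv hcont hdiff
      (fun t ht => (abs_le.1 (hdb t ht)).1) 0 ⟨le_rfl, hr.le⟩ r ⟨hr.le, le_rfl⟩ hr.le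
    simp only [zero_smul, add_zero, integral_const_mul, sub_zero] at hup hlo
    exact abs_le.2 ⟨by linarith, by linarith⟩
  -- Moving `∂ₑ` onto the weight permits subtracting the constant `u x`, which brings in the
  -- oscillation.
  have hF : r * ∫ y, fderiv ℝ u (x + r • y) e * truncPoly 2 y =
      -∫ y, (u (x + r • y) - u x) * fderiv ℝ (truncPoly 2 : E → ℝ) y e := by
    have hu1 : ContDiff ℝ 1 u := hu.of_le (by norm_num)
    have hf : ContDiff ℝ 1 (fun y => u (x + r • y) - u x) :=
      (contDiff_comp_add_smul hu1 x r).sub contDiff_const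
    rw [integral_mul_fderiv_eq_neg hf (contDiff_one_truncPoly 0)
      (fun y => truncPoly_eq_zero 1) (fun y => fderiv_truncPoly_eq_zero 0), neg_neg,
      ← integral_const_mul]
    refine integral_congr_ae (Eventually.of_forall fun y => ?_)
    simp only [fderiv_sub_const, fderiv_comp_add_smul hu1]
    ring
  have hFb : r * |∫ y, fderiv ℝ u (x + r • y) e * truncPoly 2 y| ≤ ω * (4 * ‖e‖) * V := by
    rw [← abs_of_pos hr, ← abs_mul, abs_of_pos hr, hF, abs_neg]
    refine abs_integral_le_of_eq_zero (fun y hy => by simp [fderiv_truncPoly_eq_zero 0 hy])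
      fun y hy => ?_
    rw [abs_mul]
    refine mul_le_mul (hosc _ (add_smul_mem_ball hr.le le_rfl hr hy)) ?_ (abs_nonneg _) hω
    refine (abs_fderiv_truncPoly_le 0 y e).trans_eq ?_
    norm_num
  rw [abs_sub_comm] at h
  have h3 := abs_sub_abs_le_abs_sub (fderiv ℝ u x e * I)
    (∫ y, fderiv ℝ u (x + r • y) e * truncPoly 2 y)
  have h4 : |∫ y, fderiv ℝ u (x + r • y) e * truncPoly 2 y| ≤ ω * (4 * ‖e‖) * V / r := by
    rw [le_div_iff₀ hr]; linarith
  rw [abs_mul, abs_of_pos hI0] at h3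
  rw [Real.norm_eq_abs]
  have h5 : |fderiv ℝ u x e| * I ≤ 4 * V * (ω / r + r * L) * ‖e‖ := by
    have : 4 * V * (ω / r + r * L) * ‖e‖ =
        ω * (4 * ‖e‖) * V / r + 4 * (L * ‖e‖ * V * r) := by ring
    have h6 : 0 ≤ L * ‖e‖ * V * r := by positivity
    linarith
  rw [div_mul_eq_mul_div, div_mul_eq_mul_div, le_div_iff₀ hI0]
  exact h5

end

/-! ### Weak Harnack inequality and decay of oscillation -/

section

theorem Real.exp_sub_exp_le (a b : ℝ) : Real.exp a - Real.exp b ≤ Real.exp a * (a - b) := by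
  have h1 := Real.add_one_le_exp (b - a)
  have h2 : Real.exp b = Real.exp a * Real.exp (b - a) := by rw [← Real.exp_add]; ring_nf
  have h3 := Real.exp_pos a
  rw [h2]
  nlinarith

theorem Real.le_exp_sub_exp (a b : ℝ) : Real.exp b * (a - b) ≤ Real.exp a - Real.exp b := by
  have := Real.exp_sub_exp_le b a
  linarith

variable (E : Type*) [NormedAddCommGroup E] [InnerProductSpace ℝ E] [FiniteDimensional ℝ E]
  [MeasurableSpace E] [BorelSpace E]

/-- A weak Harnack inequality for `M - u`, where `Δ u ≥ -(κ |∇u|² + B)`. -/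
theorem exists_weak_harnack {κ : ℝ} (hκ : 0 < κ) : ∃ c C : ℝ, 0 < c ∧ 0 ≤ C ∧
    ∀ (u : E → ℝ) (B : ℝ) (x₀ : E) (r M : ℝ), ContDiff ℝ 2 u → 0 ≤ B → 0 < r → M ≤ 3 →
      (∀ z ∈ Metric.ball x₀ r, |u z| ≤ 1) → (∀ z ∈ Metric.ball x₀ r, u z ≤ M) →
      (∀ z ∈ Metric.ball x₀ r, -(κ * ‖fderiv ℝ u z‖ ^ 2 + B) ≤ Laplacian.laplacian u z) →
      ∀ x ∈ Metric.ball x₀ (r / 6),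
        c * (∫ y in Metric.ball (0 : E) (1 / 4), (M - u (x₀ + (4 * (r / 6)) • y))) -
          C * B * r ^ 2 ≤ M - u x := by
  set V := volume.real (Metric.ball (0 : E) 1) with hV
  set I := ∫ y : E, truncPoly 2 y with hI
  have hV0 : 0 ≤ V := measureReal_nonneg
  have hI0 : 0 < I := integral_truncPoly_two_pos
  -- Here `9/16 = (1 - (1/2)²)²` bounds the weight below on the half ball, `exp (-κ)` comes from `u
  -- ≥ -1`, and `exp (3κ)` from `M ≤ 3`.
  refine ⟨9 / 16 * Real.exp (-κ) / (Real.exp (3 * κ) * I),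
    Real.exp κ * V / (Real.exp (3 * κ) * I), by positivity, by positivity, ?_⟩
  intro u B x₀ r M hu hB hr hM hu1 huM hΔ x hx
  set s := 4 * (r / 6) with hs
  have hs0 : 0 < s := by positivity
  set J := ∫ y in Metric.ball (0 : E) (1 / 4), (M - u (x₀ + s • y)) with hJ
  have hw : ContDiff ℝ 2 (fun x => Real.exp (κ * u x)) :=
    Real.contDiff_exp.comp (contDiff_const.mul hu)
  have hsub : Metric.ball x s ⊆ Metric.ball x₀ r := by
    refine Metric.ball_subset_ball' ?_
    rw [Metric.mem_ball] at hx
    linarith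
  have hxr : x ∈ Metric.ball x₀ r := hsub (Metric.mem_ball_self hs0)
  have hmv := mul_integral_truncPoly_sub_le hw (x := x) (r := s) (β := κ * Real.exp κ * B) hs0
    (by positivity) fun z hz => by
      rw [laplacian_exp hu]
      have h1 : -B ≤ Laplacian.laplacian u z + κ * ‖fderiv ℝ u z‖ ^ 2 := by
        linarith [hΔ z (hsub hz)]
      have h2 : Real.exp (κ * u z) ≤ Real.exp κ :=
        Real.exp_le_exp.2 (by nlinarith [(abs_le.1 (hu1 z (hsub hz))).2])
      have h3 := mul_le_mul_of_nonneg_left h1 (by positivity : 0 ≤ κ * Real.exp (κ * u z))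
      have h4 : κ * Real.exp (κ * u z) * B ≤ κ * Real.exp κ * B := by gcongr
      linarith
  rw [← hI, ← hV] at hmv
  have hwi : Integrable fun y => Real.exp (κ * u (x + s • y)) * truncPoly 2 y := by
    refine integrable_mul_of_eq_zero ?_ (continuous_truncPoly 2) fun y => truncPoly_eq_zero 1
    have := hu.continuous
    fun_prop
  have hGi : Integrable fun y =>
      (Real.exp (κ * M) - Real.exp (κ * u (x + s • y))) * truncPoly 2 y := by
    simp only [sub_mul]
    exact ((integrable_truncPoly 1).const_mul _).sub hwi
  have hG : ∫ y, (Real.exp (κ * M) - Real.exp (κ * u (x + s • y))) * truncPoly 2 y =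
      Real.exp (κ * M) * I - ∫ y, Real.exp (κ * u (x + s • y)) * truncPoly 2 y := by
    simp only [sub_mul]
    rw [integral_sub ((integrable_truncPoly 1).const_mul _) hwi, integral_const_mul]
  -- Translating by `p` recentres the average at `x₀`, so the lower bound uses one integral for all
  -- `x`. As `|p| ≤ 1/4`, the ball of radius `1/4` stays in the half ball of the weight.
  set p : E := s⁻¹ • (x₀ - x) with hp
  have hpx : ∀ y, x + s • (y + p) = x₀ + s • y := fun y => by
    rw [hp, smul_add, smul_inv_smul₀ hs0.ne']
    abel
  have hpn : ‖p‖ ≤ 1 / 4 := by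
    rw [hp, norm_smul, norm_inv, Real.norm_of_nonneg hs0.le, inv_mul_le_iff₀ hs0, ← dist_eq_norm,
      dist_comm]
    rw [Metric.mem_ball] at hx
    linarith
  have hGi' : Integrable fun y =>
      (Real.exp (κ * M) - Real.exp (κ * u (x₀ + s • y))) * truncPoly 2 (y + p) := by
    simpa only [hpx] using hGi.comp_add_right p
  have hlow : 9 / 16 * (κ * Real.exp (-κ)) * J ≤
      ∫ y, (Real.exp (κ * M) - Real.exp (κ * u (x + s • y))) * truncPoly 2 y := by
    rw [← integral_add_right_eq_self _ p]
    simp only [hpx]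
    have h1 : ∫ y in Metric.ball (0 : E) (1 / 4),
          (Real.exp (κ * M) - Real.exp (κ * u (x₀ + s • y))) * truncPoly 2 (y + p) ≤
        ∫ y, (Real.exp (κ * M) - Real.exp (κ * u (x₀ + s • y))) * truncPoly 2 (y + p) := by
      refine setIntegral_le_integral hGi' (Eventually.of_forall fun y => ?_)
      rcases le_or_gt 1 ‖y + p‖ with hy | hy
      · simp [truncPoly_eq_zero 1 hy]
      · refine mul_nonneg (sub_nonneg.2 (Real.exp_le_exp.2 ?_)) (truncPoly_nonneg _ _)
        rw [← hpx]
        exact mul_le_mul_of_nonneg_left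
          (huM _ (hsub (add_smul_mem_ball hs0.le le_rfl hs0 hy))) hκ.le
    refine le_trans ?_ h1
    rw [hJ, ← integral_const_mul]
    refine setIntegral_mono_on ?_ hGi'.integrableOn Metric.isOpen_ball.measurableSet fun y hy => ?_
    · have := hu.continuous
      exact ((by fun_prop : Continuous fun y : E => 9 / 16 * (κ * Real.exp (-κ)) *
        (M - u (x₀ + s • y))).continuousOn.integrableOn_compact
          (isCompact_closedBall 0 (1 / 4))).mono_set Metric.ball_subset_closedBall
    · rw [mem_ball_zero_iff] at hy
      have hyp : ‖y + p‖ ≤ 1 / 2 := (norm_add_le _ _).trans (by linarith)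
      have hz : x₀ + s • y ∈ Metric.ball x₀ r := by
        rw [← hpx]
        exact hsub (add_smul_mem_ball hs0.le le_rfl hs0 (hyp.trans_lt (by norm_num)))
      have hη : 9 / 16 ≤ truncPoly 2 (y + p) := by
        have h2 : (3 / 4 : ℝ) ≤ max 0 (1 - ‖y + p‖ ^ 2) :=
          le_max_of_le_right (by nlinarith [norm_nonneg (y + p)])
        have h3 := pow_le_pow_left₀ (by norm_num) h2 2
        unfold truncPoly
        linarith
      have hd := huM _ hz
      have h4 : κ * Real.exp (-κ) * (M - u (x₀ + s • y)) ≤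
          Real.exp (κ * M) - Real.exp (κ * u (x₀ + s • y)) := by
        refine le_trans ?_ (Real.le_exp_sub_exp _ _)
        have h5 : Real.exp (-κ) ≤ Real.exp (κ * u (x₀ + s • y)) :=
          Real.exp_le_exp.2 (by nlinarith [(abs_le.1 (hu1 _ hz)).1])
        have h6 := mul_le_mul_of_nonneg_right h5
          (mul_nonneg hκ.le (sub_nonneg.2 hd))
        linarith
      have h7 : 0 ≤ κ * Real.exp (-κ) * (M - u (x₀ + s • y)) := by
        have := sub_nonneg.2 hd
        positivity
      calc 9 / 16 * (κ * Real.exp (-κ)) * (M - u (x₀ + s • y))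
          = (κ * Real.exp (-κ) * (M - u (x₀ + s • y))) * (9 / 16) := by ring
        _ ≤ _ := mul_le_mul h4 hη (by norm_num) (h7.trans h4)
  have hup : Real.exp (κ * M) - Real.exp (κ * u x) ≤ Real.exp (3 * κ) * (κ * (M - u x)) := by
    refine (Real.exp_sub_exp_le _ _).trans ?_
    rw [← mul_sub]
    exact mul_le_mul_of_nonneg_right (Real.exp_le_exp.2 (by nlinarith))
      (mul_nonneg hκ.le (sub_nonneg.2 (huM x hxr)))
  have hs2 : s ^ 2 ≤ r ^ 2 := pow_le_pow_left₀ hs0.le (by linarith) 2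
  have hfin : κ * (9 / 16 * Real.exp (-κ) * J - Real.exp κ * V * B * r ^ 2) ≤
      κ * (Real.exp (3 * κ) * I * (M - u x)) := by
    have h8 := mul_le_mul_of_nonneg_right hup hI0.le
    have h9 := mul_le_mul_of_nonneg_right hs2
      (by positivity : 0 ≤ κ * Real.exp κ * B * V)
    linarith
  have hfin' := le_of_mul_le_mul_left hfin hκ
  have hEI : 0 < Real.exp (3 * κ) * I := by positivity
  calc _ = (9 / 16 * Real.exp (-κ) * J - Real.exp κ * V * B * r ^ 2) /
        (Real.exp (3 * κ) * I) := by ring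
    _ ≤ M - u x := by
      rw [div_le_iff₀ hEI]
      linarith

/-- Oscillation decay for functions with `|Δ u| ≤ κ |∇u|² + B`. -/
theorem exists_oscillation_decay {κ : ℝ} (hκ : 0 < κ) : ∃ θ C : ℝ, 0 < θ ∧ θ ≤ 1 ∧ 0 ≤ C ∧
    ∀ (u : E → ℝ) (B : ℝ) (x₀ : E) (r ω : ℝ), ContDiff ℝ 2 u → 0 ≤ B → 0 < r → ω ≤ 2 →
      (∀ z ∈ Metric.ball x₀ r, |u z| ≤ 1) →
      (∀ z ∈ Metric.ball x₀ r, |Laplacian.laplacian u z| ≤ κ * ‖fderiv ℝ u z‖ ^ 2 + B) →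
      (∀ x ∈ Metric.ball x₀ r, ∀ y ∈ Metric.ball x₀ r, u x - u y ≤ ω) →
      ∀ x ∈ Metric.ball x₀ (r / 6), ∀ y ∈ Metric.ball x₀ (r / 6),
        u x - u y ≤ (1 - θ) * ω + C * B * r ^ 2 := by
  obtain ⟨c, C, hc, hC, h⟩ := exists_weak_harnack E hκ
  set V := volume.real (Metric.ball (0 : E) (1 / 4)) with hV
  have hV0 : 0 < V := ENNReal.toReal_pos (Metric.measure_ball_pos _ _ (by norm_num)).ne'
    measure_ball_lt_top.ne
  -- Capping at 1 keeps `1 - θ` nonnegative for the iteration.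
  refine ⟨min (c * V) 1, 2 * C, lt_min (by positivity) one_pos, min_le_right _ _, by positivity, ?_⟩
  intro u B x₀ r ω hu hB hr hω2 hu1 hΔ hosc x hx y hy
  have hx₀ : x₀ ∈ Metric.ball x₀ r := Metric.mem_ball_self hr
  have hω : 0 ≤ ω := by simpa using hosc x₀ hx₀ x₀ hx₀
  have hne : (u '' Metric.ball x₀ r).Nonempty := ⟨_, mem_image_of_mem u hx₀⟩
  have hbdd : BddAbove (u '' Metric.ball x₀ r) :=
    ⟨1, by rintro _ ⟨z, hz, rfl⟩; exact (abs_le.1 (hu1 z hz)).2⟩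
  set M := sSup (u '' Metric.ball x₀ r) with hM
  have huM : ∀ z ∈ Metric.ball x₀ r, u z ≤ M := fun z hz => le_csSup hbdd (mem_image_of_mem u hz)
  have hM1 : M ≤ 1 := csSup_le hne (by rintro _ ⟨z, hz, rfl⟩; exact (abs_le.1 (hu1 z hz)).2)
  have hM1' : -1 ≤ M := (abs_le.1 (hu1 x₀ hx₀)).1.trans (huM x₀ hx₀)
  have hum : ∀ z ∈ Metric.ball x₀ r, M ≤ ω + u z := fun z hz =>
    csSup_le hne (by rintro _ ⟨z', hz', rfl⟩; linarith [hosc z' hz' z hz])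
  have h1 := h u B x₀ r M hu hB hr (by linarith) hu1 huM
    (fun z hz => (abs_le.1 (hΔ z hz)).1) x hx
  -- The upper bound for `-u` is `ω - M ≤ 2 + 1`, which is why the Harnack inequality admits levels
  -- up to 3.
  have h2 := h (-u) B x₀ r (ω - M) hu.neg hB hr (by linarith)
    (fun z hz => by simpa using hu1 z hz)
    (fun z hz => by have := hum z hz; simp only [Pi.neg_apply]; linarith)
    (fun z hz => by
      rw [InnerProductSpace.laplacian_neg, fderiv_neg, norm_neg, Pi.neg_apply, neg_le_neg_iff]
      exact (abs_le.1 (hΔ z hz)).2) y hy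
  have hi : ∀ f : E → ℝ, Continuous f →
      IntegrableOn (fun y => f (x₀ + (4 * (r / 6)) • y)) (Metric.ball (0 : E) (1 / 4)) :=
    fun f hf => ((by fun_prop : Continuous fun y : E =>
      f (x₀ + (4 * (r / 6)) • y)).continuousOn.integrableOn_compact
        (isCompact_closedBall 0 (1 / 4))).mono_set Metric.ball_subset_closedBall
  -- The two nonnegative gaps add up to `ω` pointwise, so the two Harnack bounds together gain a
  -- fixed fraction of `ω`.
  have hsum : (∫ y in Metric.ball (0 : E) (1 / 4), (M - u (x₀ + (4 * (r / 6)) • y))) +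
      (∫ y in Metric.ball (0 : E) (1 / 4), (ω - M - (-u) (x₀ + (4 * (r / 6)) • y))) = V * ω := by
    have hc := hu.continuous
    rw [← integral_add (hi (fun z => M - u z) (by fun_prop))
      (hi (fun z => ω - M - (-u) z) (by fun_prop))]
    simp [hV]
  have h3 : c * V * ω - 2 * C * B * r ^ 2 ≤ ω - (u x - u y) := by
    simp only [Pi.neg_apply] at h1 h2 hsum
    have : c * V * ω = c * (∫ y in Metric.ball (0 : E) (1 / 4), (M - u (x₀ + (4 * (r / 6)) • y))) +
      c * (∫ y in Metric.ball (0 : E) (1 / 4), (ω - M - -u (x₀ + (4 * (r / 6)) • y))) := by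
      rw [← mul_add, hsum, mul_assoc]
    linarith
  have h4 := mul_le_mul_of_nonneg_right (min_le_left (c * V) 1) hω
  linarith

/-- Oscillation decay is iterated on balls shrinking by the factor 6, after a first shrinking that
makes the inhomogeneous term negligible. -/
theorem exists_oscillation_le {κ B ε : ℝ} (hκ : 0 < κ) (hB : 0 ≤ B) (hε : 0 < ε) :
    ∃ δ : ℝ, 0 < δ ∧ δ ≤ 1 ∧ ∀ (u : E → ℝ) (x₀ : E) (r : ℝ), ContDiff ℝ 2 u → 0 < r → r ≤ 1 →
      (∀ z ∈ Metric.ball x₀ r, |u z| ≤ 1) →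
      (∀ z ∈ Metric.ball x₀ r, |Laplacian.laplacian u z| ≤ κ * ‖fderiv ℝ u z‖ ^ 2 + B) →
      ∀ x ∈ Metric.ball x₀ (δ * r), ∀ y ∈ Metric.ball x₀ (δ * r), u x - u y ≤ ε := by
  obtain ⟨θ, C, hθ, hθ1, hC, h⟩ := exists_oscillation_decay E hκ
  obtain ⟨k, hk⟩ := exists_pow_lt_of_lt_one (by positivity : 0 < ε / 4)
    (by linarith : 1 - θ < 1)
  set ε' := min (ε / 2) 2 with hε'
  have hε'0 : 0 < ε' := lt_min (by positivity) two_pos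
  -- This ensures `C B δ₀² ≤ θ ε'`, so the bound `(1 - θ)ʲ(2 - ε') + ε'` reproduces itself from `j`
  -- to `j + 1`; `ε' ≤ 2` keeps it at most 2.
  set δ₀ := min 1 (θ * ε' / (C * B + 1)) with hδ₀
  have hCB : 0 ≤ C * B := by positivity
  have hδ₀0 : 0 < δ₀ := lt_min one_pos (by positivity)
  have hδ₀1 : δ₀ ≤ 1 := min_le_left _ _
  have hδ₀' : C * B * δ₀ ^ 2 ≤ θ * ε' := by
    have h1 : δ₀ * (C * B + 1) ≤ θ * ε' := (le_div_iff₀ (by positivity)).1 (min_le_right _ _)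
    have h2 : δ₀ ^ 2 ≤ δ₀ := by nlinarith
    have h3 := mul_le_mul_of_nonneg_left h2 hCB
    linarith
  refine ⟨δ₀ / 6 ^ k, by positivity, (div_le_one (by positivity)).2
    (hδ₀1.trans (one_le_pow₀ (by norm_num))), ?_⟩
  intro u x₀ r hu hr hr1 hu1 hΔ
  have key : ∀ j : ℕ, ∀ x ∈ Metric.ball x₀ (δ₀ / 6 ^ j * r), ∀ y ∈ Metric.ball x₀ (δ₀ / 6 ^ j * r),
      u x - u y ≤ (1 - θ) ^ j * (2 - ε') + ε' := by
    intro j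
    have hle : ∀ j : ℕ, δ₀ / 6 ^ j ≤ δ₀ := fun j =>
      div_le_self hδ₀0.le (one_le_pow₀ (by norm_num))
    have hsub : ∀ j : ℕ, Metric.ball x₀ (δ₀ / 6 ^ j * r) ⊆ Metric.ball x₀ r := fun j =>
      Metric.ball_subset_ball (mul_le_of_le_one_left hr.le ((hle j).trans hδ₀1))
    induction j with
    | zero =>
      intro x hx y hy
      have h1 := (abs_le.1 (hu1 x (hsub 0 hx))).2
      have h2 := (abs_le.1 (hu1 y (hsub 0 hy))).1
      rw [pow_zero]
      linarith
    | succ j ih =>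
      have hε'2 : ε' ≤ 2 := min_le_right _ _
      have hpow1 : (1 - θ) ^ j ≤ 1 := pow_le_one₀ (by linarith) (by linarith)
      have h1 := h u B x₀ (δ₀ / 6 ^ j * r) ((1 - θ) ^ j * (2 - ε') + ε') hu hB (by positivity)
        (by nlinarith) (fun z hz => hu1 z (hsub j hz)) (fun z hz => hΔ z (hsub j hz)) ih
      have h2 : δ₀ / 6 ^ (j + 1) * r = δ₀ / 6 ^ j * r / 6 := by
        rw [pow_succ]; field_simp
      have h3 : (δ₀ / 6 ^ j * r) ^ 2 ≤ δ₀ ^ 2 :=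
        pow_le_pow_left₀ (by positivity)
          ((mul_le_of_le_one_right (by positivity) hr1).trans (hle j)) 2
      have h4 := mul_le_mul_of_nonneg_left h3 hCB
      intro x hx y hy
      rw [h2] at hx hy
      refine (h1 x hx y hy).trans ?_
      rw [pow_succ (1 - θ) j]
      linarith
  intro x hx y hy
  refine (key k x hx y hy).trans ?_
  have h1 : ε' ≤ ε / 2 := min_le_left _ _
  have h2 : 0 ≤ (1 - θ) ^ k := pow_nonneg (by linarith) _
  nlinarith

end

/-! ### Gradient bound by a weighted maximum and absorption -/

section

/-- Since `1/t = (K + 1)/τ`, the first term splits: smallness of `m` makes its `K` part at most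
`K/4`, and `m ≤ 2ω` handles the rest. The quadratic term is at most `K/4` because `tK ≤ τ`. Half of
`K` is absorbed. -/
theorem le_of_interpolation {C κ B τ t K ω d R m : ℝ} (hC : 0 < C) (hτ : 0 < τ)
    (hτκ : 4 * C * τ * κ ≤ 1 / 4) (hκ : 0 ≤ κ) (hB : 0 ≤ B) (hK : 0 ≤ K) (hd : 0 ≤ d)
    (hdR : d ≤ R) (hR : R ≤ 1) (hmε : m ≤ τ / (4 * C)) (hmω : m ≤ 2 * ω) (ht : t = τ / (K + 1))
    (ht1 : t ≤ 1) (htK : t * K ≤ τ)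
    (h : K ≤ C * (m / t + (4 * κ * (t * K) * K + t * B * d ^ 2))) :
    K ≤ 4 * C * ω / τ + 2 * C * B * R := by
  have h3 : C * (m / t) ≤ K / 4 + 2 * C * ω / τ := by
    have h4 : C * (m / t) = C * m * K / τ + C * m / τ := by
      rw [ht]; field_simp
    have h5 : C * m * K / τ ≤ C * (τ / (4 * C)) * K / τ := by
      gcongr
    have h6 : C * m / τ ≤ C * (2 * ω) / τ := by
      gcongr
    have h7 : C * (τ / (4 * C)) * K / τ = K / 4 := by field_simp
    have h8 : C * (2 * ω) / τ = 2 * C * ω / τ := by ring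
    linarith
  have h4 : C * (4 * κ * (t * K) * K) ≤ K / 4 := by
    have h5 : C * (4 * κ * (t * K) * K) ≤ C * (4 * κ * τ * K) := by gcongr
    have h6 := mul_le_mul_of_nonneg_right hτκ hK
    linarith
  have h5 : C * (t * B * d ^ 2) ≤ C * (1 * B * R) := by
    have : d ^ 2 ≤ R := by nlinarith
    gcongr
  have h6 : 4 * C * ω / τ = 2 * (2 * C * ω / τ) := by ring
  linarith

variable (E : Type*) [NormedAddCommGroup E] [InnerProductSpace ℝ E] [FiniteDimensional ℝ E]
  [MeasurableSpace E] [BorelSpace E]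

/-- The gradient estimate at the centre of a ball, with a constant depending only on `κ`, `B` and
the space. -/
theorem exists_gradient_bound {κ B : ℝ} (hκ : 0 < κ) (hB : 0 ≤ B) :
    ∃ c : ℝ, 0 < c ∧ ∀ (u : E → ℝ) (x₀ : E) (r ω : ℝ), ContDiff ℝ 2 u → 0 < r → r ≤ 1 →
      (∀ z ∈ Metric.ball x₀ r, |u z| ≤ 1) →
      (∀ z ∈ Metric.ball x₀ r, |Laplacian.laplacian u z| ≤ κ * ‖fderiv ℝ u z‖ ^ 2 + B) →
      (∀ z ∈ Metric.ball x₀ r, |u z - u x₀| ≤ ω) →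
      ‖fderiv ℝ u x₀‖ ≤ c * (1 + ω / r) := by
  set C₁ := 4 * volume.real (Metric.ball (0 : E) 1) / (∫ y : E, truncPoly 2 y) + 1 with hC₁
  have hI0 : 0 < ∫ y : E, truncPoly 2 y := integral_truncPoly_two_pos
  have hC₁0 : 0 < C₁ := by positivity
  -- The second entry allows absorption of the quadratic term; the first keeps the ball of radius `t
  -- * d` about the maximum point within half the distance to the boundary.
  set τ := min (1 / 2) (1 / (16 * C₁ * κ)) with hτ
  have hτ0 : 0 < τ := lt_min (by norm_num) (by positivity)
  have hτ2 : τ ≤ 1 / 2 := min_le_left _ _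
  have hτκ : 4 * C₁ * τ * κ ≤ 1 / 4 := by
    have h1 : τ * (16 * C₁ * κ) ≤ 1 := (le_div_iff₀ (by positivity)).1 (min_le_right _ _)
    linarith
  obtain ⟨δ, hδ0, hδ1, hosc⟩ := exists_oscillation_le E hκ hB
    (by positivity : 0 < τ / (4 * C₁))
  refine ⟨8 * C₁ / (τ * δ) + 2 * C₁ * B, by positivity, ?_⟩
  intro u x₀ r ω hu hr hr1 hu1 hΔ huω
  have hω : 0 ≤ ω := by simpa using huω x₀ (Metric.mem_ball_self hr)
  set R := δ * r / 2 with hR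
  have hR0 : 0 < R := by positivity
  have hRδ : R < δ * r := by have := mul_pos hδ0 hr; linarith
  have hδr : δ * r ≤ r := mul_le_of_le_one_left hr.le hδ1
  have hR1 : R ≤ 1 := by linarith
  have hsub : ∀ z, dist z x₀ ≤ R → z ∈ Metric.ball x₀ (δ * r) := fun z hz => hz.trans_lt hRδ
  have hsub' : ∀ z, dist z x₀ ≤ R → z ∈ Metric.ball x₀ r := fun z hz =>
    Metric.ball_subset_ball hδr (hsub z hz)
  have hgc : Continuous fun z => ‖fderiv ℝ u z‖ := (hu.continuous_fderiv (by norm_num)).norm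
  -- The weight vanishes on the boundary sphere, and maximality gives `|∇u| ≤ 2K/d` wherever the
  -- distance to that sphere is at least `d/2`.
  obtain ⟨x₁, hx₁, hmax⟩ := (isCompact_closedBall x₀ R).exists_isMaxOn
    ⟨x₀, Metric.mem_closedBall_self hR0.le⟩
    (by fun_prop : Continuous fun z => (R - dist z x₀) * ‖fderiv ℝ u z‖).continuousOn
  set d := R - dist x₁ x₀ with hd
  set K := d * ‖fderiv ℝ u x₁‖ with hK
  have hd0 : 0 ≤ d := sub_nonneg.2 hx₁
  have hdR : d ≤ R := sub_le_self _ dist_nonneg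
  have hK0 : 0 ≤ K := by positivity
  have hKx : ∀ z, dist z x₀ ≤ R → (R - dist z x₀) * ‖fderiv ℝ u z‖ ≤ K := fun z hz => hmax hz
  have hx₀ : R * ‖fderiv ℝ u x₀‖ ≤ K := by simpa using hKx x₀ (by simpa using hR0.le)
  have hKb : K ≤ 4 * C₁ * ω / τ + 2 * C₁ * B * R := by
    rcases hd0.eq_or_lt with hd0 | hd0
    · rw [hK, ← hd0, zero_mul]; positivity
    set t := τ / (K + 1) with ht
    have ht0 : 0 < t := by positivity
    have htτ : t ≤ τ := div_le_self hτ0.le (by linarith)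
    have htK : t * K ≤ τ := by
      rw [ht, div_mul_eq_mul_div, div_le_iff₀ (by positivity)]
      nlinarith
    have hz : ∀ z ∈ Metric.ball x₁ (t * d), d / 2 ≤ R - dist z x₀ := fun z hz => by
      have h1 := dist_triangle z x₁ x₀
      rw [Metric.mem_ball] at hz
      nlinarith
    have hzR : ∀ z ∈ Metric.ball x₁ (t * d), dist z x₀ ≤ R := fun z hz' => by
      linarith [hz z hz']
    have hgrad := norm_fderiv_le_of_laplacian_le hu (x := x₁) (r := t * d)
      (ω := min (τ / (4 * C₁)) (2 * ω)) (L := κ * (2 * K / d) ^ 2 + B) (by positivity)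
      (by positivity) (by positivity)
      (fun z hz' => by
        have hzδ := hsub z (hzR z hz')
        refine le_min (abs_le.2 ⟨?_, hosc u x₀ r hu hr hr1 hu1 hΔ z hzδ x₁ (hsub _ hx₁)⟩) ?_
        · linarith [hosc u x₀ r hu hr hr1 hu1 hΔ x₁ (hsub _ hx₁) z hzδ]
        · have h1 := huω z (hsub' z (hzR z hz'))
          have h2 := huω x₁ (hsub' x₁ hx₁)
          rw [abs_le] at h1 h2 ⊢
          constructor <;> linarith)
      (fun z hz' => by
        have h1 := hΔ z (hsub' z (hzR z hz'))
        have h2 := hKx z (hzR z hz')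
        have h3 := mul_le_mul_of_nonneg_right (hz z hz') (norm_nonneg (fderiv ℝ u z))
        have h4 : ‖fderiv ℝ u z‖ ≤ 2 * K / d := by
          rw [le_div_iff₀ hd0]
          linarith
        have h5 := mul_le_mul_of_nonneg_left (pow_le_pow_left₀ (norm_nonneg _) h4 2) hκ.le
        linarith)
    set m := min (τ / (4 * C₁)) (2 * ω) with hm
    have hm0 : 0 ≤ m := by positivity
    have h1 : ‖fderiv ℝ u x₁‖ ≤ C₁ * (m / (t * d) + t * d * (κ * (2 * K / d) ^ 2 + B)) :=
      hgrad.trans (mul_le_mul_of_nonneg_right (by linarith) (by positivity))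
    have h2 : K ≤ C₁ * (m / t + (4 * κ * (t * K) * K + t * B * d ^ 2)) := by
      refine (mul_le_mul_of_nonneg_left h1 hd0.le).trans_eq ?_
      field_simp
      ring
    exact le_of_interpolation hC₁0 hτ0 hτκ hκ.le hB hK0 hd0.le hdR hR1 (min_le_left _ _)
      (min_le_right _ _) ht (by linarith) htK h2
  have h1 : R * ‖fderiv ℝ u x₀‖ ≤ R * ((8 * C₁ / (τ * δ)) * (ω / r) + 2 * C₁ * B) := by
    refine (hx₀.trans hKb).trans_eq ?_
    rw [hR]
    field_simp
    ring
  have h2 := le_of_mul_le_mul_left h1 hR0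
  have h3 : 0 ≤ 8 * C₁ / (τ * δ) := by positivity
  have h4 : 0 ≤ 2 * C₁ * B * (ω / r) := by positivity
  linarith

/-! ### Localisation by a cutoff and conclusion -/

theorem exists_contDiff_eqOn_ball {E : Type*} [NormedAddCommGroup E] [InnerProductSpace ℝ E]
    {D : Set E} {χ : E → ℝ} (hD : IsOpen D) (hχ : ContDiffOn ℝ 2 χ D) {x₀ : E} {r r₀ : ℝ}
    (hr : 0 < r) (hrr : r < r₀) (hball : Metric.ball x₀ r₀ ⊆ D) :
    ∃ u : E → ℝ, ContDiff ℝ 2 u ∧ EqOn u χ (Metric.ball x₀ r) := by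
  let f : ContDiffBump x₀ := ⟨r, (r + r₀) / 2, hr, by linarith⟩
  refine ⟨fun x => f x * χ x, contDiff_iff_contDiffAt.2 fun x => ?_, fun x hx => ?_⟩
  · by_cases hx : x ∈ Metric.ball x₀ r₀
    · exact f.contDiffAt.mul (hχ.contDiffAt (hD.mem_nhds (hball hx)))
    · have hx' : x ∉ tsupport f := by
        rw [f.tsupport_eq]
        intro h
        have h1 : dist x x₀ ≤ (r + r₀) / 2 := h
        exact hx (Metric.mem_ball.2 (by linarith))
      have h0 : (fun x => f x * χ x) =ᶠ[𝓝 x] fun _ => 0 := by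
        filter_upwards [notMem_tsupport_iff_eventuallyEq.1 hx'] with y hy
        rw [hy]; simp
      exact contDiffAt_const.congr_of_eventuallyEq h0
  · simp only []
    rw [f.one_of_mem_closedBall (Metric.ball_subset_closedBall hx), one_mul]

end

/-- The interior gradient estimate holds with a constant independent of `D` and `χ`. -/
theorem exists_forall_interiorGradientEstimate (n : ℕ) (a b : ℝ) :
    ∃ c : ℝ, 0 < c ∧ ∀ (D : Set (EuclideanSpace ℝ (Fin n))) (χ : EuclideanSpace ℝ (Fin n) → ℝ),
      PoissonDiffIneq n a b D χ → InteriorGradientEstimate n c D χ := by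
  obtain ⟨c, hc, h⟩ := exists_gradient_bound (EuclideanSpace ℝ (Fin n))
    (by positivity : 0 < |a| + 1) (abs_nonneg b)
  refine ⟨5 * c, by positivity, fun D χ hχ x₀ r₀ hr₀ hball => ?_⟩
  -- Strictly below `r₀` there is room for the cutoff, and the gradient bound needs `r ≤ 1`.
  set r := min r₀ 1 / 2 with hr
  have hr0 : 0 < r := by positivity
  have hrr : r < r₀ := by linarith [min_le_left r₀ 1]
  have hr1 : r ≤ 1 := by linarith [min_le_right r₀ 1]
  obtain ⟨u, hu, hEq⟩ := exists_contDiff_eqOn_ball hχ.isOpen hχ.contDiffOn hr0 hrr hball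
  have hsub : Metric.ball x₀ r ⊆ Metric.ball x₀ r₀ := Metric.ball_subset_ball hrr.le
  have hev : ∀ z ∈ Metric.ball x₀ r, u =ᶠ[𝓝 z] χ := fun z hz =>
    hEq.eventuallyEq_of_mem (Metric.isOpen_ball.mem_nhds hz)
  have hx₀ : x₀ ∈ Metric.ball x₀ r := Metric.mem_ball_self hr0
  have habs : ∀ z ∈ Metric.ball x₀ r₀, |χ z| ≤ 1 := fun z hz =>
    abs_le.2 (hχ.mem_Icc z (hball hz))
  set ω := sSup ((fun x => |χ x - χ x₀|) '' Metric.ball x₀ r₀) with hω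
  have hle2 : ∀ z ∈ Metric.ball x₀ r₀, |χ z - χ x₀| ≤ 2 := fun z hz => by
    have h1 := abs_sub (χ z) (χ x₀)
    linarith [habs z hz, habs x₀ (Metric.mem_ball_self hr₀)]
  have hωle : ∀ z ∈ Metric.ball x₀ r₀, |χ z - χ x₀| ≤ ω := fun z hz =>
    le_csSup ⟨2, by rintro _ ⟨y, hy, rfl⟩; exact hle2 y hy⟩
      (mem_image_of_mem (fun x => |χ x - χ x₀|) hz)
  have hω0 : 0 ≤ ω := by simpa using hωle x₀ (Metric.mem_ball_self hr₀)
  have hω2 : ω ≤ 2 := csSup_le ⟨_, mem_image_of_mem (fun x => |χ x - χ x₀|) (Metric.mem_ball_self hr₀)⟩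
    (by rintro _ ⟨y, hy, rfl⟩; exact hle2 y hy)
  have hgrad := h u x₀ r ω hu hr0 hr1
    (fun z hz => by rw [hEq hz]; exact habs z (hsub hz))
    (fun z hz => by
      rw [(InnerProductSpace.laplacian_congr_nhds (hev z hz)).self_of_nhds, (hev z hz).fderiv_eq]
      refine (hχ.laplacian_le z (hball (hsub hz))).trans (add_le_add ?_ (le_abs_self b))
      exact mul_le_mul_of_nonneg_right (by linarith [le_abs_self a]) (sq_nonneg _))
    (fun z hz => by rw [hEq hz, hEq hx₀]; exact hωle z (hsub hz))
  rw [(hev x₀ hx₀).fderiv_eq] at hgrad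
  -- For `r₀ ≥ 1` the bound `ω ≤ 2` gives the 4; otherwise `r = r₀/2` gives the other term.
  have hωr : ω / r ≤ 4 + 2 * (ω / r₀) := by
    have hr₀' : 0 ≤ ω / r₀ := by positivity
    rcases le_total r₀ 1 with h1 | h1
    · rw [hr, min_eq_left h1]
      have : ω / (r₀ / 2) = 2 * (ω / r₀) := by field_simp
      linarith
    · rw [hr, min_eq_right h1]
      have : ω / (1 / 2) = 2 * ω := by field_simp
      linarith
  have h1 : 0 ≤ ω / r₀ := by positivity
  calc ‖fderiv ℝ χ x₀‖ ≤ c * (1 + ω / r) := hgrad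
    _ ≤ c * (5 * (1 + ω / r₀)) := by
      refine mul_le_mul_of_nonneg_left ?_ hc.le
      linarith
    _ = 5 * c * (1 + ω / r₀) := by ring

theorem mainTheorem5 (n : ℕ) (hn : 2 < n) (a b : ℝ) :
    (∀ (D : Set (EuclideanSpace ℝ (Fin n))) (χ : EuclideanSpace ℝ (Fin n) → ℝ),
      PoissonDiffIneq n a b D χ →
        ∃ c : ℝ, 0 < c ∧ InteriorGradientEstimate n c D χ) ∧
    (a ≤ poissonConst n →
      ∃ c : ℝ, 0 < c ∧
        ∀ (D : Set (EuclideanSpace ℝ (Fin n))) (χ : EuclideanSpace ℝ (Fin n) → ℝ),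
          PoissonDiffIneq n a b D χ → InteriorGradientEstimate n c D χ) := by
  obtain ⟨c, hc, h⟩ := exists_forall_interiorGradientEstimate n a b
  exact ⟨fun D χ hχ => ⟨c, hc, h D χ hχ⟩, fun _ => ⟨c, hc, h⟩⟩
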